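/- A degree sequence of length $n$ is a sequence $d=(d_1,\dots,d_n)$ of positive integers $d_i\le n-1$ with even sum; it is graphic if there is a simple graph on $\{v_1,\dots,v_n\}$ in which $v_i$ has degree $d_i$ for every $i$. For positive integers $n>c_1\ge c_2$ and an integer $\Sigma$, let $\mathbb{D}(n,\Sigma,c_1,c_2)$ be the set of all degree sequences $d$ of length $n$ with $\sum_i d_i=\Sigma$ and $c_2\le d_i\le c_1$ for all $i$; call it fully graphic if each of its members is graphic. For $1\le p,q\le n$ let $D+1_{+q}^{+p}$ be the sequence obtained from $D$ by adding $1$ to its $p$-th and $1$ to its $q$-th term (so $2$ is added to the $p$-th term if $p=q$). An edge-abundant trail in a simple graph $G$ between vertices $v$ and $v'$ (not necessarily distinct) is a sequence of vertices $v=x_0,x_1,\dots,x_\ell=v'$ with $\ell$ odd and $x_{i}\neq x_{i+1}$, such that the pairs $\{x_i,x_{i+1}\}$, $0\le i<\ell$, are pairwise distinct, and are alternately edges and non-edges of $G$, starting with an edge; $\ell$ is its length. **Theorem 2.3.** Suppose that $\mathbb{D}(n,\Sigma,c_1,c_2)$ is fully graphic, $D\in\mathbb{D}(n,\Sigma,c_1,c_2)$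 and $1\le p,q\le n$ (possibly $p=q$). Let $G$ be a simple graph on $\{v_1,\dots,v_n\}$ with degree sequence $D+1_{+q}^{+p}$ in which $v_p$ and $v_q$ have the same set of neighbours, $\Gamma_G(v_p)=\Gamma_G(v_q)$. Then there is an edge-abundant trail of length at most $11$ between $v_p$ and $v_q$ in $G$. -/

import Mathlib

namespace DegSeq

/-- A degree sequence of length `n`: positive integers, none exceeding `n - 1`, with even sum. -/
def IsDegreeSequence {n : ℕ} (d : Fin n → ℕ) : Prop :=
  (∀ i, 0 < d i ∧ d i < n) ∧ Even (∑ i, d i)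

open scoped Classical in
/-- The simple graph `G` on the vertices `v_i` (`i : Fin n`) has degree sequence `d`. -/
def Realizes {n : ℕ} (G : SimpleGraph (Fin n)) (d : Fin n → ℕ) : Prop :=
  ∀ i, G.degree i = d i

/-- A sequence is graphic if it has a realization by a simple graph. -/
def IsGraphic {n : ℕ} (d : Fin n → ℕ) : Prop :=
  ∃ G : SimpleGraph (Fin n), Realizes G d

/-- The simple region `𝔻(n, Σ, a, b)`: the degree sequences of length `n` with sum `Σ` and all
of whose terms lie between `b` and `a`. -/
def simpleRegion (n S a b : ℕ) : Set (Fin n → ℕ) :=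
  {d | IsDegreeSequence d ∧ (∀ i, b ≤ d i ∧ d i ≤ a) ∧ ∑ i, d i = S}

/-- A region is fully graphic if each of its members is graphic. -/
def FullyGraphic {n : ℕ} (𝔻 : Set (Fin n → ℕ)) : Prop :=
  ∀ d ∈ 𝔻, IsGraphic d

/-- The perturbed sequence `D + 1^{+p}_{+q}`; if `p = q`, then `2` is added at `p`. -/
def perturb {n : ℕ} (D : Fin n → ℕ) (p q : Fin n) : Fin n → ℕ :=
  D + Pi.single p 1 + Pi.single q 1

variable {V : Type*}

/-- A walk in the complete graph on the vertex set of `G` is a sequence of vertices in which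
consecutive ones are distinct, so each step is an edge or a non-edge of `G`. It alternates if, of
any two consecutive steps, exactly one is an edge of `G`. -/
def IsAlternating (G : SimpleGraph V) {u v : V} (w : (⊤ : SimpleGraph V).Walk u v) : Prop :=
  ∀ i, i + 1 < w.length →
    (G.Adj (w.getVert i) (w.getVert (i + 1)) ↔ ¬ G.Adj (w.getVert (i + 1)) (w.getVert (i + 2)))

/-- An edge-abundant trail: an alternating trail of edges and non-edges of `G` (no pair of
vertices is used twice, vertices may repeat) of odd length whose first element is an edge. -/
structure IsEdgeAbundant (G : SimpleGraph V) {u v : V} (w : (⊤ : SimpleGraph V).Walk u v) :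
    Prop where
  isTrail : w.IsTrail
  alternating : IsAlternating G w
  odd_length : Odd w.length
  first_edge : G.Adj (w.getVert 0) (w.getVert 1)

/-- A `k`-witness trail: an edge-abundant trail of length at most `k`. -/
def IsWitnessTrail (G : SimpleGraph V) (k : ℕ) {u v : V} (w : (⊤ : SimpleGraph V).Walk u v) :
    Prop :=
  IsEdgeAbundant G w ∧ w.length ≤ k

end DegSeq

/-! Suppose there is no such trail, and let N be the common neighbourhood of p and q. The missing
trails force G to look almost like a split graph around p, and counting then contradicts full
graphicness.

Counting (`no_saturated_pair`): suppose there are a clique Y, a disjoint independent set Z joined to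
p and q by p, q ∈ X ⊆ Z, every vertex outside Y ∪ Z joined to all of Y, at most one edge-pair from X
to the complement of Y, and a set A ⊆ Y of at least c₂ vertices, one of them adjacent to p, that is
complete to everything outside X ∪ Y. Some member of the region is as large as possible on Y and as
small as possible on Z. Its Erdős–Gallai inequality is nearly an equality for G, but the surplus 2
at p and q, against a defect of at most 1 from X, breaks it.

Structure: N is a clique. Take for X the twins and the vertices missing some element of N, for Y the
set N with the ends of the stems p, a, x, y, and for Z the set X with the vertices outside Y not
complete to Y. An obstruction (an edge between missers, a nonedge in Y, an edge in Z) closes up to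
an alternating walk from p to q of length 5, 7 or 9. It can fail to be a trail only by repeating a
pair, typically when both halves leave p and q through the same neighbour. So the obstructions share
one neighbour a₀ of p, which may be discarded because p has degree at least c₂ + 1, or they share
one edge x₀y₀, which the permitted defect absorbs (`dominates_or_bottleneck`). If adjacent missers
exist, then p = q and both miss one vertex a; dropping a from Y costs only the edge pa
(`false_of_triangle`). -/

namespace DegSeq

/-! ### Counting adjacent pairs, and the Erdős–Gallai inequality -/

section Counting

open scoped Classical in
/-- The number of pairs `(u, t) ∈ U × T` that are adjacent in `G`. -/
noncomputable def adjPairs {V : Type*} (G : SimpleGraph V) (U T : Finset V) : ℕ :=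
  ∑ u ∈ U, ∑ t ∈ T, if G.Adj u t then 1 else 0

variable {V : Type*} (G : SimpleGraph V)

theorem adjPairs_comm (U T : Finset V) : adjPairs G U T = adjPairs G T U := by
  classical
  unfold adjPairs
  rw [Finset.sum_comm]
  exact Finset.sum_congr rfl fun t _ => Finset.sum_congr rfl fun u _ => by
    simp only [G.adj_comm u t]

theorem adjPairs_eq_sum_left (U T : Finset V) :
    adjPairs G U T = ∑ u ∈ U, adjPairs G {u} T := by
  simp [adjPairs]

theorem adjPairs_eq_sum_right (U T : Finset V) :
    adjPairs G U T = ∑ t ∈ T, adjPairs G {t} U := by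
  rw [adjPairs_comm, adjPairs_eq_sum_left]

theorem adjPairs_add_compl [Fintype V] [DecidableEq V] (U T : Finset V) :
    adjPairs G U T + adjPairs G U Tᶜ = adjPairs G U Finset.univ := by
  unfold adjPairs
  rw [← Finset.sum_add_distrib]
  refine Finset.sum_congr rfl fun u _ => ?_
  rw [Finset.sum_add_sum_compl]

theorem adjPairs_add_sdiff [DecidableEq V] (U : Finset V) {S T : Finset V} (h : S ⊆ T) :
    adjPairs G U S + adjPairs G U (T \ S) = adjPairs G U T := by
  unfold adjPairs
  rw [← Finset.sum_add_distrib]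
  refine Finset.sum_congr rfl fun u _ => ?_
  rw [add_comm, Finset.sum_sdiff h]

theorem adjPairs_mono_right (U : Finset V) {S T : Finset V} (h : S ⊆ T) :
    adjPairs G U S ≤ adjPairs G U T :=
  Finset.sum_le_sum fun _ _ => Finset.sum_le_sum_of_subset h

theorem adjPairs_singleton_le (u : V) (T : Finset V) : adjPairs G {u} T ≤ T.card := by
  classical
  simp only [adjPairs, Finset.sum_singleton]
  calc _ ≤ ∑ t ∈ T, 1 := Finset.sum_le_sum fun t _ => by split_ifs <;> simp
    _ = T.card := by simp

theorem adjPairs_singleton_eq {u : V} {T : Finset V} (h : ∀ t ∈ T, G.Adj u t) :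
    adjPairs G {u} T = T.card := by
  classical
  simp only [adjPairs, Finset.sum_singleton]
  rw [Finset.sum_congr rfl fun t ht => if_pos (h t ht)]
  simp

theorem adjPairs_eq_zero {U T : Finset V} (h : ∀ u ∈ U, ∀ t ∈ T, ¬ G.Adj u t) :
    adjPairs G U T = 0 := by
  classical
  unfold adjPairs
  exact Finset.sum_eq_zero fun u hu => Finset.sum_eq_zero fun t ht => if_neg (h u hu t ht)

theorem one_le_adjPairs_singleton {u t : V} {T : Finset V} (ht : t ∈ T) (h : G.Adj u t) :
    1 ≤ adjPairs G {u} T := by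
  classical
  have := adjPairs_mono_right G {u} (Finset.singleton_subset_iff.2 ht)
  rwa [adjPairs_singleton_eq G (by simpa using h), Finset.card_singleton] at this

theorem adjPairs_singleton_add_one_le {u : V} {T : Finset V} (hu : u ∈ T) :
    adjPairs G {u} T + 1 ≤ T.card := by
  classical
  rw [← adjPairs_add_sdiff G {u} (Finset.singleton_subset_iff.2 hu),
    adjPairs_eq_zero G (T := {u}) (by simp)]
  have := adjPairs_singleton_le G u (T \ {u})
  rw [Finset.card_sdiff_of_subset (Finset.singleton_subset_iff.2 hu), Finset.card_singleton] at this
  have : 0 < T.card := Finset.card_pos.2 ⟨u, hu⟩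
  omega

theorem adjPairs_singleton_add_one_eq {u : V} {T : Finset V} (hu : u ∈ T)
    (h : ∀ t ∈ T, t ≠ u → G.Adj u t) : adjPairs G {u} T + 1 = T.card := by
  classical
  rw [← adjPairs_add_sdiff G {u} (Finset.singleton_subset_iff.2 hu),
    adjPairs_eq_zero G (T := {u}) (by simp), adjPairs_singleton_eq G (T := T \ {u}) (by
      intro t ht
      simp only [Finset.mem_sdiff, Finset.mem_singleton] at ht
      exact h t ht.1 ht.2)]
  rw [Finset.card_sdiff_of_subset (Finset.singleton_subset_iff.2 hu), Finset.card_singleton]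
  have : 0 < T.card := Finset.card_pos.2 ⟨u, hu⟩
  omega

theorem Realizes.adjPairs_singleton_univ {n : ℕ} {H : SimpleGraph (Fin n)} {d : Fin n → ℕ}
    (h : Realizes H d) (v : Fin n) : adjPairs H {v} Finset.univ = d v := by
  classical
  rw [← h v, adjPairs, Finset.sum_singleton, ← SimpleGraph.card_neighborFinset_eq_degree,
    SimpleGraph.neighborFinset_eq_filter, Finset.card_filter]

theorem Realizes.adjPairs_univ {n : ℕ} {H : SimpleGraph (Fin n)} {d : Fin n → ℕ}
    (h : Realizes H d) (U : Finset (Fin n)) : adjPairs H U Finset.univ = ∑ v ∈ U, d v := by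
  rw [adjPairs_eq_sum_left]
  exact Finset.sum_congr rfl fun v _ => h.adjPairs_singleton_univ v

/-- The Erdős–Gallai inequality for a pair of disjoint sets of vertices. -/
theorem Realizes.sum_le {n : ℕ} {H : SimpleGraph (Fin n)} {d : Fin n → ℕ}
    (h : Realizes H d) {U T : Finset (Fin n)} (hUT : Disjoint U T) :
    ∑ v ∈ U, d v + U.card * T.card + U.card ≤ U.card * n + ∑ v ∈ T, d v := by
  have h1 := adjPairs_add_compl H U T
  rw [h.adjPairs_univ] at h1
  have h2 : adjPairs H U T ≤ ∑ v ∈ T, d v := by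
    rw [adjPairs_comm, ← h.adjPairs_univ]
    exact adjPairs_mono_right H T (Finset.subset_univ _)
  have h3 : adjPairs H U Tᶜ + U.card ≤ U.card * Tᶜ.card := by
    rw [adjPairs_eq_sum_left, Finset.card_eq_sum_ones U, ← Finset.sum_add_distrib,
      Finset.sum_mul]
    refine Finset.sum_le_sum fun u hu => ?_
    rw [one_mul]
    exact adjPairs_singleton_add_one_le H
      (Finset.mem_compl.2 (Finset.disjoint_left.1 hUT hu))
  have h4 : Tᶜ.card + T.card = n := by
    rw [Finset.card_compl_add_card, Fintype.card_fin]
  have h5 : U.card * n = U.card * Tᶜ.card + U.card * T.card := by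
    rw [← mul_add, h4]
  omega

/-- Between two functions one finds a function with any intermediate sum. -/
theorem exists_between_sum_eq {ι : Type*} (s : Finset ι) (f g : ι → ℕ) (hfg : f ≤ g) (t : ℕ)
    (hf : ∑ i ∈ s, f i ≤ t) (hg : t ≤ ∑ i ∈ s, g i) :
    ∃ h : ι → ℕ, f ≤ h ∧ h ≤ g ∧ ∑ i ∈ s, h i = t := by
  classical
  induction t, hf using Nat.le_induction with
  | base => exact ⟨f, le_rfl, hfg, rfl⟩
  | succ t _ ih =>
    obtain ⟨h, h1, h2, h3⟩ := ih (by omega)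
    obtain ⟨i, hi, hlt⟩ : ∃ i ∈ s, h i < g i := by
      by_contra! hc
      have := Finset.sum_le_sum hc
      omega
    refine ⟨h + Pi.single i 1, fun j => (h1 j).trans (by simp), fun j => ?_, ?_⟩
    · rcases eq_or_ne j i with rfl | hj
      · simpa using hlt
      · simpa [hj] using h2 j
    · simp [Finset.sum_add_distrib, h3, Finset.sum_pi_single', hi]

end Counting

/-! ### Full graphicness against an almost saturated pair -/

section Core

variable {n S c₁ c₂ : ℕ}

/-- Full graphicness is only used in this form: bounds that agree on a set prescribe the degrees
there, and the remaining terms adjust the sum. -/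
theorem exists_graphic_of_bounds (hc₂ : 0 < c₂) (hn : c₁ < n) (hS : Even S)
    (hfull : FullyGraphic (simpleRegion n S c₁ c₂)) {f g : Fin n → ℕ} (hfg : f ≤ g)
    (hf : ∀ i, c₂ ≤ f i) (hg : ∀ i, g i ≤ c₁) (hfS : ∑ i, f i ≤ S) (hgS : S ≤ ∑ i, g i) :
    ∃ d : Fin n → ℕ, f ≤ d ∧ d ≤ g ∧ ∑ i, d i = S ∧ IsGraphic d := by
  obtain ⟨d, h1, h2, h3⟩ := exists_between_sum_eq Finset.univ f g hfg S hfS hgS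
  have h4 : ∀ i, c₂ ≤ d i ∧ d i ≤ c₁ := fun i =>
    ⟨(hf i).trans (h1 i), (h2 i).trans (hg i)⟩
  refine ⟨d, h1, h2, h3, hfull d ⟨⟨fun i => ?_, h3 ▸ hS⟩, h4, h3⟩⟩
  have := h4 i
  omega

theorem sum_ite_mem_const (T : Finset (Fin n)) (a b : ℕ) :
    ∑ i, (if i ∈ T then a else b) = T.card * a + Tᶜ.card * b := by
  rw [← Finset.sum_add_sum_compl T, Finset.sum_congr rfl fun i hi => if_pos hi,
    Finset.sum_congr (s₁ := Tᶜ) rfl fun i hi => if_neg (Finset.mem_compl.1 hi)]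
  simp

theorem sum_eq_card_mul {T : Finset (Fin n)} {d : Fin n → ℕ} {c : ℕ} (h : ∀ i ∈ T, d i = c) :
    ∑ i ∈ T, d i = T.card * c := by
  rw [Finset.sum_congr rfl h]; simp

theorem card_add_card_compl_fin (T : Finset (Fin n)) : T.card + Tᶜ.card = n := by
  rw [Finset.card_add_card_compl, Fintype.card_fin]

/-- If the sum is small, a member of the region is constantly `c₂` off `Y`. -/
theorem two_mul_sum_le_of_le (hc₂ : 0 < c₂) (hc : c₂ ≤ c₁) (hn : c₁ < n) (hS : Even S)
    (hfull : FullyGraphic (simpleRegion n S c₁ c₂)) (Y : Finset (Fin n)) (hlow : n * c₂ ≤ S)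
    (h : S ≤ Y.card * c₁ + Yᶜ.card * c₂) :
    S + Y.card ≤ Y.card * Y.card + 2 * (Yᶜ.card * c₂) := by
  obtain ⟨d, h1, h2, h3, H, hH⟩ := exists_graphic_of_bounds hc₂ hn hS hfull
    (f := fun _ => c₂) (g := fun i => if i ∈ Y then c₁ else c₂)
    (fun i => by dsimp only; split_ifs <;> omega) (fun _ => le_rfl)
    (fun i => by split_ifs <;> omega) (by simpa using hlow)
    (by rw [sum_ite_mem_const]; exact h)
  have hY : ∑ i ∈ Yᶜ, d i = Yᶜ.card * c₂ := sum_eq_card_mul fun i hi => by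
    have : c₂ ≤ d i := h1 i
    have := h2 i
    simp only [Finset.mem_compl.1 hi, if_false] at this
    omega
  have h4 := hH.sum_le (disjoint_compl_right : Disjoint Y Yᶜ)
  have h5 := Finset.sum_add_sum_compl Y d
  have h6 : Y.card * n = Y.card * Y.card + Y.card * Yᶜ.card := by
    rw [← mul_add, card_add_card_compl_fin]
  omega

/-- If the sum is large, a member of the region is constantly `c₁` off `Z`. -/
theorem le_sum_of_le (hc₂ : 0 < c₂) (hc : c₂ ≤ c₁) (hn : c₁ < n) (hS : Even S)
    (hfull : FullyGraphic (simpleRegion n S c₁ c₂)) (Z : Finset (Fin n)) (hup : S ≤ n * c₁)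
    (h : Z.card * c₂ + Zᶜ.card * c₁ ≤ S) :
    2 * (Zᶜ.card * c₁) + Zᶜ.card ≤ S + Zᶜ.card * Zᶜ.card := by
  obtain ⟨d, h1, h2, h3, H, hH⟩ := exists_graphic_of_bounds hc₂ hn hS hfull
    (f := fun i => if i ∈ Z then c₂ else c₁) (g := fun _ => c₁)
    (fun i => by dsimp only; split_ifs <;> omega)
    (fun i => by split_ifs <;> omega) (fun _ => le_rfl)
    (by rw [sum_ite_mem_const]; exact h) (by simpa using hup)
  have hZ : ∑ i ∈ Zᶜ, d i = Zᶜ.card * c₁ := sum_eq_card_mul fun i hi => by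
    have : d i ≤ c₁ := h2 i
    have := h1 i
    simp only [Finset.mem_compl.1 hi, if_false] at this
    omega
  have h4 := hH.sum_le (disjoint_compl_left : Disjoint Zᶜ Z)
  have h5 := Finset.sum_add_sum_compl Z d
  have h6 : Zᶜ.card * n = Zᶜ.card * Z.card + Zᶜ.card * Zᶜ.card := by
    rw [← mul_add, card_add_card_compl_fin]
  omega

/-- In the middle range, a member of the region is `c₁` on `Y` and `c₂` on `Z`. -/
theorem card_mul_le_of_between (hc₂ : 0 < c₂) (hc : c₂ ≤ c₁) (hn : c₁ < n) (hS : Even S)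
    (hfull : FullyGraphic (simpleRegion n S c₁ c₂)) {Y Z : Finset (Fin n)} (hYZ : Disjoint Y Z)
    (h₁ : Y.card * c₁ + Yᶜ.card * c₂ ≤ S) (h₂ : S ≤ Z.card * c₂ + Zᶜ.card * c₁) :
    Y.card * c₁ + Y.card * Z.card + Y.card ≤ Y.card * n + Z.card * c₂ := by
  obtain ⟨d, h1, h2, h3, H, hH⟩ := exists_graphic_of_bounds hc₂ hn hS hfull
    (f := fun i => if i ∈ Y then c₁ else c₂) (g := fun i => if i ∈ Z then c₂ else c₁)
    (fun i => by
      have : i ∈ Y → i ∉ Z := fun h => Finset.disjoint_left.1 hYZ h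
      dsimp only; split_ifs <;> first | omega | tauto)
    (fun i => by split_ifs <;> omega)
    (fun i => by split_ifs <;> omega)
    (by rw [sum_ite_mem_const]; exact h₁) (by rw [sum_ite_mem_const]; exact h₂)
  have hZ : ∑ i ∈ Z, d i = Z.card * c₂ := sum_eq_card_mul fun i hi => by
    have h1 := h1 i
    have h2 := h2 i
    have h3 : i ∉ Y := fun h => Finset.disjoint_left.1 hYZ h hi
    simp only [hi, h3, if_false, if_true] at h1 h2
    omega
  have hY : ∑ i ∈ Y, d i = Y.card * c₁ := sum_eq_card_mul fun i hi => by
    have h1 := h1 i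
    have h2 := h2 i
    have h3 : i ∉ Z := Finset.disjoint_left.1 hYZ hi
    simp only [hi, h3, if_false, if_true] at h1 h2
    omega
  have h4 := hH.sum_le hYZ
  rwa [hY, hZ] at h4

theorem perturb_apply (D : Fin n → ℕ) (p q v : Fin n) :
    perturb D p q v = D v + (if v = p then 1 else 0) + (if v = q then 1 else 0) := by
  simp [perturb, Pi.single_apply]

theorem sum_perturb (D : Fin n → ℕ) {p q : Fin n} {T : Finset (Fin n)} (hp : p ∈ T)
    (hq : q ∈ T) : ∑ v ∈ T, perturb D p q v = ∑ v ∈ T, D v + 2 := by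
  simp [perturb_apply, Finset.sum_add_distrib, hp, hq]

/-- A graph realizing a perturbed member of a fully graphic region has no clique `Y` and
independent set `Z` that are almost saturated in the sense of the hypotheses. -/
theorem no_saturated_pair (hc₂ : 0 < c₂) (hc : c₂ ≤ c₁) (hn : c₁ < n)
    (hfull : FullyGraphic (simpleRegion n S c₁ c₂))
    {D : Fin n → ℕ} (hD : D ∈ simpleRegion n S c₁ c₂) {p q : Fin n} {G : SimpleGraph (Fin n)}
    (hG : Realizes G (perturb D p q)) {A X Y Z : Finset (Fin n)}
    (hAY : A ⊆ Y) (hXZ : X ⊆ Z) (hYZ : Disjoint Y Z)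
    (hY : ∀ u ∈ Y, ∀ v ∈ Y, u ≠ v → G.Adj u v) (hZ : ∀ u ∈ Z, ∀ v ∈ Z, ¬ G.Adj u v)
    (hAX : ∀ a ∈ A, ∀ v, v ∉ Y → v ∉ X → G.Adj a v)
    (hYZ' : ∀ y ∈ Y, ∀ v, v ∉ Y → v ∉ Z → G.Adj y v)
    (hdef : adjPairs G X Yᶜ ≤ 1) (hp : p ∈ X) (hq : q ∈ X)
    (hcard : c₂ ≤ A.card) {a : Fin n} (ha : a ∈ A) (hpa : G.Adj p a) : False := by
  obtain ⟨⟨-, heven⟩, hbd, hsum⟩ := hD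
  rw [hsum] at heven
  have hdeg := hG.adjPairs_singleton_univ
  have htot : adjPairs G Finset.univ Finset.univ = S + 2 := by
    rw [hG.adjPairs_univ, sum_perturb D (Finset.mem_univ p) (Finset.mem_univ q), hsum]
  have hnX : ∀ {v}, v ∉ X → perturb D p q v = D v := fun {v} hv => by
    have h1 : v ≠ p := by rintro rfl; exact hv hp
    have h2 : v ≠ q := by rintro rfl; exact hv hq
    simp [perturb_apply, h1, h2]
  have hYX : ∀ {v}, v ∈ Y → v ∉ X := fun hv hx => Finset.disjoint_left.1 hYZ hv (hXZ hx)
  have hXY : X ⊆ Yᶜ := fun v hv => Finset.mem_compl.2 fun h => hYX h hv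
  have hlow : n * c₂ ≤ S := by
    rw [← hsum]
    calc n * c₂ = ∑ _i : Fin n, c₂ := by simp
      _ ≤ _ := Finset.sum_le_sum fun i _ => (hbd i).1
  have hup : S ≤ n * c₁ := by
    rw [← hsum]
    calc _ ≤ ∑ _i : Fin n, c₁ := Finset.sum_le_sum fun i _ => (hbd i).2
      _ = n * c₁ := by simp
  have hsumX : X.card * c₂ + 2 ≤ ∑ v ∈ X, perturb D p q v := by
    rw [sum_perturb D hp hq, Finset.card_eq_sum_ones, Finset.sum_mul]
    simp only [one_mul]
    gcongr with i
    exact (hbd i).1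
  have hXdeg : adjPairs G X Y + adjPairs G X Yᶜ = ∑ v ∈ X, perturb D p q v := by
    rw [adjPairs_add_compl, hG.adjPairs_univ]
  have hout : ∀ v, v ∉ Y → v ∉ X → c₂ ≤ adjPairs G {v} A := fun v h1 h2 => by
    rw [adjPairs_singleton_eq G fun a ha => (hAX a ha v h1 h2).symm]; exact hcard
  -- the small range
  have hsmall : Y.card * c₁ + Yᶜ.card * c₂ ≤ S := by
    by_contra! hcon
    have h1 := two_mul_sum_le_of_le hc₂ hc hn heven hfull Y hlow hcon.le
    have h2 : adjPairs G Y Y + Y.card = Y.card * Y.card := by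
      rw [adjPairs_eq_sum_left, Finset.card_eq_sum_ones, Finset.sum_mul,
        ← Finset.sum_add_distrib]
      refine Finset.sum_congr rfl fun u hu => ?_
      rw [adjPairs_singleton_add_one_eq G hu fun t ht h => hY u hu t ht h.symm]
      simp
    have h3 := adjPairs_add_compl G Finset.univ Y
    rw [adjPairs_comm G _ Y, adjPairs_comm G _ Yᶜ, ← adjPairs_add_compl G Y Y,
      ← adjPairs_add_compl G Yᶜ Y, adjPairs_comm G Y Yᶜ] at h3
    -- The 4 is twice the surplus 2 at p and q. Pairs from X into Yᶜ are lost twice in the first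
    -- term and regained once in the second; the last term restores the rest. With `hdef` this beats
    -- the Erdős–Gallai bound `h1` by 1.
    have h4 : 2 * (Yᶜ.card * c₂) + 4 ≤ 2 * adjPairs G Yᶜ Y + adjPairs G Yᶜ Yᶜ
        + adjPairs G X Yᶜ := by
      have e1 := adjPairs_add_sdiff G Y hXY
      have e2 := adjPairs_add_sdiff G Yᶜ hXY
      rw [adjPairs_comm G Y Yᶜ, adjPairs_comm G Y X] at e1
      rw [adjPairs_comm G Yᶜ X] at e2
      have e3 : (Yᶜ \ X).card * c₂ ≤ adjPairs G Y (Yᶜ \ X) := by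
        rw [adjPairs_eq_sum_right, Finset.card_eq_sum_ones, Finset.sum_mul]
        refine Finset.sum_le_sum fun v hv => ?_
        simp only [Finset.mem_sdiff, Finset.mem_compl] at hv
        rw [one_mul]
        exact (hout v hv.1 hv.2).trans (adjPairs_mono_right G _ hAY)
      have e4 : Yᶜ.card * c₂ = X.card * c₂ + (Yᶜ \ X).card * c₂ := by
        rw [← add_mul, add_comm, Finset.card_sdiff_add_card_eq_card hXY]
      omega
    omega
  -- the large range
  have hlarge : S ≤ Z.card * c₂ + Zᶜ.card * c₁ := by
    by_contra! hcon
    have h1 := le_sum_of_le hc₂ hc hn heven hfull Z hup hcon.le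
    -- The vertex a is joined to p ∈ X and to all of Xᶜ except itself, so its degree is at least the
    -- size of Xᶜ.
    have hXcard : n ≤ X.card + c₁ := by
      have e1 := adjPairs_add_compl G {a} X
      rw [hdeg, hnX (hYX (hAY ha))] at e1
      have e2 : adjPairs G {a} Xᶜ + 1 = Xᶜ.card :=
        adjPairs_singleton_add_one_eq G (Finset.mem_compl.2 (hYX (hAY ha))) fun t ht hta => by
          by_cases hty : t ∈ Y
          · exact hY a (hAY ha) t hty hta.symm
          · exact hAX a ha t hty (Finset.mem_compl.1 ht)
      have e3 := one_le_adjPairs_singleton G hp hpa.symm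
      have e4 := (hbd a).2
      have e5 := card_add_card_compl_fin X
      omega
    have hZc := card_add_card_compl_fin Z
    -- A vertex of Y spends all but one of the places in Zᶜ from a degree of at most c₁; any other
    -- vertex sees at most one element of X, and X is large by `hXcard`.
    have hper : ∀ v ∈ Zᶜ, adjPairs G {v} Z + Zᶜ.card ≤ c₁ + 1 := fun v hv => by
      have hvZ := Finset.mem_compl.1 hv
      by_cases hvY : v ∈ Y
      · have e1 := adjPairs_add_compl G {v} Z
        rw [hdeg, hnX (hYX hvY)] at e1
        have e2 : adjPairs G {v} Zᶜ + 1 = Zᶜ.card :=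
          adjPairs_singleton_add_one_eq G hv fun t ht htv => by
            by_cases hty : t ∈ Y
            · exact hY v hvY t hty htv.symm
            · exact hYZ' v hvY t hty (Finset.mem_compl.1 ht)
        have e3 := (hbd v).2
        omega
      · have e1 := adjPairs_add_sdiff G {v} hXZ
        have e2 := adjPairs_singleton_le G v (Z \ X)
        have e3 : adjPairs G {v} X ≤ 1 := by
          refine le_trans ?_ hdef
          rw [adjPairs_comm]
          exact adjPairs_mono_right G X (Finset.singleton_subset_iff.2 (Finset.mem_compl.2 hvY))
        have e4 := Finset.card_sdiff_add_card_eq_card hXZ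
        omega
    have h3 := adjPairs_add_compl G Finset.univ Z
    rw [adjPairs_comm G _ Z, adjPairs_comm G _ Zᶜ, ← adjPairs_add_compl G Z Z,
      ← adjPairs_add_compl G Zᶜ Z, adjPairs_comm G Z Zᶜ, adjPairs_eq_zero G hZ] at h3
    have h4 : adjPairs G Zᶜ Z + Zᶜ.card * Zᶜ.card ≤ Zᶜ.card * c₁ + Zᶜ.card := by
      rw [adjPairs_eq_sum_left]
      have := Finset.sum_le_sum hper
      simp only [Finset.sum_add_distrib, Finset.sum_const, smul_eq_mul, mul_one] at this
      exact this
    have h5 : adjPairs G Zᶜ Zᶜ + Zᶜ.card ≤ Zᶜ.card * Zᶜ.card := by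
      rw [adjPairs_eq_sum_left]
      have := Finset.sum_le_sum fun v (hv : v ∈ Zᶜ) => adjPairs_singleton_add_one_le G hv
      simp only [Finset.sum_add_distrib, Finset.sum_const, smul_eq_mul, mul_one] at this
      exact this
    omega
  -- the middle range
  have h1 := card_mul_le_of_between hc₂ hc hn heven hfull hYZ hsmall hlarge
  have h2 : ∑ v ∈ Y, perturb D p q v ≤ Y.card * c₁ := by
    rw [Finset.card_eq_sum_ones, Finset.sum_mul]
    refine Finset.sum_le_sum fun v hv => ?_
    rw [hnX (hYX hv), one_mul]
    exact (hbd v).2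
  rw [← hG.adjPairs_univ, ← adjPairs_add_compl G Y Z, ← adjPairs_add_sdiff G Y hXZ,
    adjPairs_comm G Y X] at h2
  have h3 : adjPairs G Y Zᶜ + Y.card = Y.card * Zᶜ.card := by
    rw [adjPairs_eq_sum_left, Finset.card_eq_sum_ones Y, Finset.sum_mul,
      ← Finset.sum_add_distrib]
    refine Finset.sum_congr rfl fun u hu => ?_
    rw [one_mul]
    refine adjPairs_singleton_add_one_eq G
      (Finset.mem_compl.2 (Finset.disjoint_left.1 hYZ hu)) fun t ht htu => ?_
    by_cases hty : t ∈ Y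
    · exact hY u hu t hty htu.symm
    · exact hYZ' u hu t hty (Finset.mem_compl.1 ht)
  have h4 : (Z \ X).card * c₂ ≤ adjPairs G Y (Z \ X) := by
    rw [adjPairs_eq_sum_right, Finset.card_eq_sum_ones, Finset.sum_mul]
    refine Finset.sum_le_sum fun v hv => ?_
    rw [Finset.mem_sdiff] at hv
    rw [one_mul]
    exact (hout v (fun h => Finset.disjoint_left.1 hYZ h hv.1) hv.2).trans
      (adjPairs_mono_right G _ hAY)
  have h5 : Z.card * c₂ = X.card * c₂ + (Z \ X).card * c₂ := by
    rw [← add_mul, add_comm, Finset.card_sdiff_add_card_eq_card hXZ]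
  have h6 : Y.card * n = Y.card * Z.card + Y.card * Zᶜ.card := by
    rw [← mul_add, card_add_card_compl_fin]
  -- The degree sum over Y is at most |Y|c₁, yet X alone sends at least |X|c₂ + 2 − 1 pairs into Y,
  -- one more than `h1` allows.
  omega

end Core

/-! ### Alternating vertex lists and trails -/

section Trails

variable {V : Type*} (G : SimpleGraph V) (q : V)

/-- The vertices `u, l, q` are joined alternately by edges and nonedges of `G`, the first and the
last pair being edges. -/
def Alternates : V → List V → Prop
  | u, [] => G.Adj u q
  -- An odd number of inner vertices would give a walk of even length.
  | _, [_] => False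
  | u, a :: b :: l => G.Adj u a ∧ a ≠ b ∧ ¬ G.Adj a b ∧ Alternates b l

/-- The pairs at even positions of the sequence `u, l, q`. -/
def evenPairs : V → List V → List (Sym2 V)
  | u, [] => [s(u, q)]
  | _, [_] => []
  | u, a :: b :: l => s(u, a) :: evenPairs b l

/-- The pairs at odd positions of the sequence `u, l, q`. -/
def oddPairs : List V → List (Sym2 V)
  | a :: b :: l => s(a, b) :: oddPairs l
  | _ => []

variable {G q}

theorem Alternates.mem_edgeSet_of_mem_evenPairs : ∀ {u : V} {l : List V}, Alternates G q u l →
    ∀ e ∈ evenPairs q u l, e ∈ G.edgeSet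
  | u, [], h, e, he => by
    simp only [evenPairs, List.mem_singleton] at he
    exact he ▸ h
  | _, [_], h, _, _ => h.elim
  | u, a :: b :: l, h, e, he => by
    simp only [evenPairs, List.mem_cons] at he
    rcases he with rfl | he
    · exact h.1
    · exact h.2.2.2.mem_edgeSet_of_mem_evenPairs e he

theorem Alternates.notMem_edgeSet_of_mem_oddPairs : ∀ {u : V} {l : List V}, Alternates G q u l →
    ∀ e ∈ oddPairs l, e ∉ G.edgeSet
  | u, [], h, e, he => by simp [oddPairs] at he
  | _, [_], h, _, _ => h.elim
  | u, a :: b :: l, h, e, he => by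
    simp only [oddPairs, List.mem_cons] at he
    rcases he with rfl | he
    · exact h.2.2.1
    · exact h.2.2.2.notMem_edgeSet_of_mem_oddPairs e he

theorem Alternates.exists_walk : ∀ {u : V} {l : List V}, Alternates G q u l →
    ∃ w : (⊤ : SimpleGraph V).Walk u q, w.length = l.length + 1 ∧ Odd w.length ∧
      IsAlternating G w ∧ G.Adj (w.getVert 0) (w.getVert 1) ∧
      w.edges.Perm (evenPairs q u l ++ oddPairs l)
  | u, [], h => by
    refine ⟨.cons h.ne .nil, rfl, ⟨0, rfl⟩, fun i hi => ?_, ?_, ?_⟩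
    · simp at hi
    · simpa [Alternates] using h
    · simp [evenPairs, oddPairs]
  | _, [_], h => h.elim
  | u, a :: b :: l, ⟨h1, h2, h3, h4⟩ => by
    obtain ⟨w, hl, ho, ha, hf, hp⟩ := h4.exists_walk
    refine ⟨.cons (v := a) h1.ne (.cons h2 w), by simp [hl], ?_, fun i hi => ?_, ?_, ?_⟩
    · simpa [add_assoc] using ho.add_even (even_two)
    · match i with
      | 0 => simpa using ⟨fun _ => h3, fun _ => h1⟩
      | 1 => simpa [h3] using hf
      | i + 2 => simpa using ha i (by simp at hi; omega)
    · simpa using h1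
    · simp only [SimpleGraph.Walk.edges_cons, evenPairs, oddPairs, List.cons_append]
      refine List.Perm.cons _ ?_
      exact (hp.cons _).trans List.perm_middle.symm

/-- Even pairs are edges and odd pairs are nonedges, so repetitions need to be excluded only within
each class. Ten inner vertices give length 11. -/
theorem Alternates.exists_isWitnessTrail {p : V} {l : List V} (h : Alternates G q p l)
    (hl : l.length ≤ 10) (hE : (evenPairs q p l).Nodup) (hO : (oddPairs l).Nodup) :
    ∃ w : (⊤ : SimpleGraph V).Walk p q, IsWitnessTrail G 11 w := by
  obtain ⟨w, h1, h2, h3, h4, h5⟩ := h.exists_walk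
  refine ⟨w, ⟨⟨h5.nodup_iff.2 ?_⟩, h3, h2, h4⟩, by omega⟩
  refine List.nodup_append.2 ⟨hE, hO, fun e he f hf hef => ?_⟩
  exact h.notMem_edgeSet_of_mem_oddPairs f hf (hef ▸ h.mem_edgeSet_of_mem_evenPairs e he)

end Trails

/-! ### Consequences of explicit alternating walks -/

section Blossoms

variable {V : Type*} {G : SimpleGraph V} {p q : V}

/-- `p` and `q` have the same neighbours and there is no edge-abundant trail of length at most
`11` between them. -/
structure NoShortTrail (G : SimpleGraph V) (p q : V) : Prop where
  adj_iff : ∀ v, G.Adj p v ↔ G.Adj q v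
  no_trail : ∀ l : List V, l.length ≤ 10 → Alternates G q p l → (evenPairs q p l).Nodup →
    ¬ (oddPairs l).Nodup

/-- `x` is a nonneighbour of the neighbour `a` of `p`. -/
def Misses (G : SimpleGraph V) (p a x : V) : Prop :=
  G.Adj p a ∧ a ≠ x ∧ ¬ G.Adj a x

/-- `v` is adjacent to all neighbours of `p`, but it is not adjacent to `p` and
different from `p` and `q`. -/
def Outer (G : SimpleGraph V) (p q v : V) : Prop :=
  v ≠ p ∧ v ≠ q ∧ ¬ G.Adj p v ∧ ∀ a, G.Adj p a → G.Adj a v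

namespace NoShortTrail

/-- Otherwise p, a, b, q is a trail. The other lemmas of this part follow the same pattern: the list
given to `no_trail` is the interior of the forbidden walk, and the hypotheses keep its pairs
distinct. -/
theorem adj_of_adj (h : NoShortTrail G p q) {a b : V} (ha : G.Adj p a) (hb : G.Adj p b)
    (hab : a ≠ b) : G.Adj a b := by
  by_contra hn
  have e₁ := h.adj_iff
  have hsymm := G.adj_comm
  have hirr := fun v => G.irrefl (v := v)
  refine h.no_trail [a, b] (by simp) ?_ ?_ ?_ <;>
    simp only [Alternates, evenPairs, oddPairs, List.nodup_cons, List.mem_cons,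
      List.not_mem_nil, Sym2.eq_iff, not_or] <;>
    (repeat' apply And.intro) <;> grind

theorem misses_facts (h : NoShortTrail G p q) {a x : V} (hx : Misses G p a x) :
    (G.Adj p a ∧ G.Adj q a ∧ a ≠ x ∧ ¬ G.Adj a x) ∧ x ≠ p ∧ x ≠ q ∧ ¬ G.Adj p x := by
  have hqa := (h.adj_iff a).1 hx.1
  refine ⟨⟨hx.1, hqa, hx.2⟩, ?_, ?_, fun hpx => hx.2.2 (h.adj_of_adj hx.1 hpx hx.2.1)⟩
  · rintro rfl; exact hx.2.2 hx.1.symm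
  · rintro rfl; exact hx.2.2 hqa.symm

/-- The walk p, a, x, x', b, q repeats a pair only if its first and last edges coincide. -/
theorem eq_of_edge (h : NoShortTrail G p q) {a b x x' : V} (hx : Misses G p a x)
    (hxx : G.Adj x x') (hx' : Misses G p b x') : a = b ∧ p = q := by
  by_contra hn
  have hx := h.misses_facts hx
  have hx' := h.misses_facts hx'
  have hsymm := G.adj_comm
  have hirr := fun v => G.irrefl (v := v)
  refine h.no_trail [a, x, x', b] (by simp) ?_ ?_ ?_ <;>
    simp only [Alternates, evenPairs, oddPairs, List.nodup_cons, List.mem_cons,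
      List.not_mem_nil, Sym2.eq_iff, not_or] <;>
    (repeat' apply And.intro) <;> grind

theorem eq_of_nonedge (h : NoShortTrail G p q) {a b x x' y y' : V} (hx : Misses G p a x)
    (hxy : G.Adj x y) (hy : Outer G p q y) (hne : y ≠ y') (hyy : ¬ G.Adj y y')
    (hy' : Outer G p q y') (hxy' : G.Adj x' y') (hx' : Misses G p b x') : a = b := by
  by_contra hn
  have hx := h.misses_facts hx
  rw [Outer] at hy
  rw [Outer] at hy'
  have hx' := h.misses_facts hx'
  have hsymm := G.adj_comm
  have hirr := fun v => G.irrefl (v := v)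
  refine h.no_trail [a, x, y, y', x', b] (by simp) ?_ ?_ ?_ <;>
    simp only [Alternates, evenPairs, oddPairs, List.nodup_cons, List.mem_cons,
      List.not_mem_nil, Sym2.eq_iff, not_or] <;>
    (repeat' apply And.intro) <;> grind

/-- The case y = y' is allowed, a closed detour y, z, z', y; `hne` keeps the edges xy and x'y'
distinct. -/
theorem eq_of_outer_edge (h : NoShortTrail G p q) {a b x x' y y' z z' : V} (hx : Misses G p a x)
    (hxy : G.Adj x y) (hy : Outer G p q y) (hyz : y ≠ z) (hyz' : ¬ G.Adj y z)
    (hz : Outer G p q z) (hzz : G.Adj z z') (hz' : Outer G p q z') (hzy : z' ≠ y')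
    (hzy' : ¬ G.Adj z' y') (hy' : Outer G p q y') (hxy' : G.Adj x' y') (hx' : Misses G p b x')
    (hne : x ≠ x' ∨ y ≠ y') : a = b := by
  by_contra hn
  have hx := h.misses_facts hx
  rw [Outer] at hy
  rw [Outer] at hz
  rw [Outer] at hz'
  rw [Outer] at hy'
  have hx' := h.misses_facts hx'
  have hsymm := G.adj_comm
  have hirr := fun v => G.irrefl (v := v)
  refine h.no_trail [a, x, y, z, z', y', x', b] (by simp) ?_ ?_ ?_ <;>
    simp only [Alternates, evenPairs, oddPairs, List.nodup_cons, List.mem_cons,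
      List.not_mem_nil, Sym2.eq_iff, not_or] <;>
    (repeat' apply And.intro) <;> grind

/-- A nonedge x₂y would let the walk that enters through a leave along the stem through c instead of
returning to a. -/
theorem adj_of_nonedge (h : NoShortTrail G p q) {a c x x₁ x₂ y y₁ y₂ : V} (hx₁ : Misses G p a x₁)
    (hxy₁ : G.Adj x₁ y₁) (hy₁ : Outer G p q y₁) (hne : y₁ ≠ y₂) (hyy : ¬ G.Adj y₁ y₂)
    (hx₂ : Misses G p a x₂) (hxy₂ : G.Adj x₂ y₂) (hy₂ : Outer G p q y₂) (hx : Misses G p c x)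
    (hxy : G.Adj x y) (hy : Outer G p q y) (hac : a ≠ c) (hn₁ : y ≠ y₁ ∧ y ≠ y₂)
    (hn₂ : x ≠ x₁ ∧ x ≠ x₂) : G.Adj x₂ y := by
  by_contra hn
  have hx₁ := h.misses_facts hx₁
  rw [Outer] at hy₁
  have hx₂ := h.misses_facts hx₂
  rw [Outer] at hy₂
  have hx := h.misses_facts hx
  rw [Outer] at hy
  have hsymm := G.adj_comm
  have hirr := fun v => G.irrefl (v := v)
  refine h.no_trail [a, x₁, y₁, y₂, x₂, y, x, c] (by simp) ?_ ?_ ?_ <;>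
    simp only [Alternates, evenPairs, oddPairs, List.nodup_cons, List.mem_cons,
      List.not_mem_nil, Sym2.eq_iff, not_or] <;>
    (repeat' apply And.intro) <;> grind

theorem adj_of_outer_edge (h : NoShortTrail G p q) {a c x x₁ x₂ y y₁ y₂ z₁ z₂ : V}
    (hx₁ : Misses G p a x₁) (hxy₁ : G.Adj x₁ y₁) (hy₁ : Outer G p q y₁)
    (hyz₁ : y₁ ≠ z₁ ∧ ¬ G.Adj y₁ z₁) (hz₁ : Outer G p q z₁) (hzz : G.Adj z₁ z₂)
    (hz₂ : Outer G p q z₂) (hyz₂ : y₂ ≠ z₂ ∧ ¬ G.Adj y₂ z₂) (hne : y₁ ≠ y₂)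
    (hx₂ : Misses G p a x₂) (hxy₂ : G.Adj x₂ y₂) (hy₂ : Outer G p q y₂) (hx : Misses G p c x)
    (hxy : G.Adj x y) (hy : Outer G p q y) (hac : a ≠ c) (hn₁ : y ≠ y₁ ∧ y ≠ y₂)
    (hn₂ : x ≠ x₁ ∧ x ≠ x₂) : G.Adj x₂ y := by
  by_contra hn
  have hx₁ := h.misses_facts hx₁
  rw [Outer] at hy₁
  rw [Outer] at hz₁
  rw [Outer] at hz₂
  have hx₂ := h.misses_facts hx₂
  rw [Outer] at hy₂
  have hx := h.misses_facts hx
  rw [Outer] at hy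
  have hsymm := G.adj_comm
  have hirr := fun v => G.irrefl (v := v)
  refine h.no_trail [a, x₁, y₁, z₁, z₂, y₂, x₂, y, x, c] (by simp) ?_ ?_ ?_ <;>
    simp only [Alternates, evenPairs, oddPairs, List.nodup_cons, List.mem_cons,
      List.not_mem_nil, Sym2.eq_iff, not_or] <;>
    (repeat' apply And.intro) <;> grind

/-- The detour y₁, z₁, z₁', y₁ (nonedge, edge, nonedge) changes parity, so y₁ can be left by the
edge to z₂ after being entered by an edge. -/
theorem eq_of_two_outer_edges (h : NoShortTrail G p q) {a₁ a₂ x₁ x₂ y₁ y₂ z₁ z₁' z₂ : V}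
    (hx₁ : Misses G p a₁ x₁) (hxy₁ : G.Adj x₁ y₁) (hy₁ : Outer G p q y₁)
    (hyz₁ : y₁ ≠ z₁ ∧ ¬ G.Adj y₁ z₁) (hz₁ : Outer G p q z₁) (hzz : G.Adj z₁ z₁')
    (hz₁' : Outer G p q z₁') (hyz₁' : y₁ ≠ z₁' ∧ ¬ G.Adj y₁ z₁') (hyz : G.Adj y₁ z₂)
    (hz₂ : Outer G p q z₂) (hyz₂ : y₂ ≠ z₂ ∧ ¬ G.Adj y₂ z₂) (hne : y₁ ≠ y₂)
    (hy₂ : Outer G p q y₂) (hxy₂ : G.Adj x₂ y₂) (hx₂ : Misses G p a₂ x₂) : a₁ = a₂ := by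
  by_contra hn
  have hx₁ := h.misses_facts hx₁
  rw [Outer] at hy₁
  rw [Outer] at hz₁
  rw [Outer] at hz₁'
  rw [Outer] at hz₂
  rw [Outer] at hy₂
  have hx₂ := h.misses_facts hx₂
  have hsymm := G.adj_comm
  have hirr := fun v => G.irrefl (v := v)
  refine h.no_trail [a₁, x₁, y₁, z₁, z₁', y₁, z₂, y₂, x₂, a₂] (by simp) ?_ ?_ ?_ <;>
    simp only [Alternates, evenPairs, oddPairs, List.nodup_cons, List.mem_cons,
      List.not_mem_nil, Sym2.eq_iff, not_or] <;>
    (repeat' apply And.intro) <;> grind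

/-- Running around a, x₁, x₂, a lets the walk enter and leave a by edges. -/
theorem not_adj_of_triangle (h : NoShortTrail G p q) {a b c x₁ x₂ : V} (hx₁ : Misses G p a x₁)
    (hxx : G.Adj x₁ x₂) (hx₂ : Misses G p a x₂) (hb : Misses G p c b) (hac : a ≠ c) :
    ¬ G.Adj a b := by
  by_contra hn
  have hx₁ := h.misses_facts hx₁
  have hx₂ := h.misses_facts hx₂
  have hb := h.misses_facts hb
  have hsymm := G.adj_comm
  have hirr := fun v => G.irrefl (v := v)
  refine h.no_trail [a, x₁, x₂, a, b, c] (by simp) ?_ ?_ ?_ <;>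
    simp only [Alternates, evenPairs, oddPairs, List.nodup_cons, List.mem_cons,
      List.not_mem_nil, Sym2.eq_iff, not_or] <;>
    (repeat' apply And.intro) <;> grind

theorem false_of_misses (h : NoShortTrail G p q) {a c x y z z' : V} (hz : Misses G p a z)
    (hzz : G.Adj z z') (hzy : z' ≠ y) (hzy' : ¬ G.Adj z' y) (hy : Outer G p q y)
    (hxy : G.Adj x y) (hx : Misses G p c x) (hac : a ≠ c) (hzx : z ≠ x) : False := by
  have hz := h.misses_facts hz
  rw [Outer] at hy
  have hx := h.misses_facts hx
  have hsymm := G.adj_comm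
  have hirr := fun v => G.irrefl (v := v)
  refine h.no_trail [a, z, z', y, x, c] (by simp) ?_ ?_ ?_ <;>
    simp only [Alternates, evenPairs, oddPairs, List.nodup_cons, List.mem_cons,
      List.not_mem_nil, Sym2.eq_iff, not_or] <;>
    (repeat' apply And.intro) <;> grind

/-- Two parity-changing detours, at a and at y, joined by the edge ay; the length 11 is attained. -/
theorem false_of_triangle (h : NoShortTrail G p q) {a c x x₁ x₂ y z z' : V}
    (hx₁ : Misses G p a x₁) (hxx : G.Adj x₁ x₂) (hx₂ : Misses G p a x₂) (hy : Outer G p q y)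
    (hyz : y ≠ z ∧ ¬ G.Adj y z) (hz : Outer G p q z) (hzz : G.Adj z z') (hz' : Outer G p q z')
    (hyz' : y ≠ z' ∧ ¬ G.Adj y z') (hxy : G.Adj x y) (hx : Misses G p c x) (hac : a ≠ c) :
    False := by
  have hx₁ := h.misses_facts hx₁
  have hx₂ := h.misses_facts hx₂
  rw [Outer] at hy
  rw [Outer] at hz
  rw [Outer] at hz'
  have hx := h.misses_facts hx
  have hsymm := G.adj_comm
  have hirr := fun v => G.irrefl (v := v)
  refine h.no_trail [a, x₁, x₂, a, y, z, z', y, x, c] (by simp) ?_ ?_ ?_ <;>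
    simp only [Alternates, evenPairs, oddPairs, List.nodup_cons, List.mem_cons,
      List.not_mem_nil, Sym2.eq_iff, not_or] <;>
    (repeat' apply And.intro) <;> grind

end NoShortTrail

end Blossoms

/-! ### Localizing the obstructions -/

section Dichotomy

variable {V : Type*} {G : SimpleGraph V} {p q : V}

/-- An alternating path `p, a, x, y` to a nonneighbour `y` of `p`. -/
def Stem (G : SimpleGraph V) (p a x y : V) : Prop :=
  Misses G p a x ∧ G.Adj x y ∧ ¬ G.Adj p y

/-- Any two vertices that miss some neighbour of `p` are nonadjacent. -/
def MissersIndep (G : SimpleGraph V) (p : V) : Prop :=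
  ∀ ⦃a b x x'⦄, Misses G p a x → Misses G p b x' → ¬ G.Adj x x'

theorem Outer.of_forall {v : V} (hp : v ≠ p) (hq : v ≠ q)
    (hpv : ¬ G.Adj p v) (hm : ∀ a, ¬ Misses G p a v) : Outer G p q v := by
  refine ⟨hp, hq, hpv, fun a ha => ?_⟩
  by_contra hn
  exact hm a ⟨ha, fun e => hpv (e ▸ ha), hn⟩

namespace NoShortTrail

theorem outer_of_stem (h : NoShortTrail G p q) (hX : MissersIndep G p) {a x y : V}
    (hs : Stem G p a x y) : Outer G p q y := by
  have hx := (h.misses_facts hs.1).2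
  refine Outer.of_forall ?_ ?_ hs.2.2 fun b hb => hX hs.1 hb hs.2.1
  · rintro rfl; exact hx.2.2 hs.2.1.symm
  · rintro rfl; exact hx.2.2 ((h.adj_iff _).2 hs.2.1.symm)

/-- All bad pairs are reached through the single neighbour `a₀` of `p`. -/
structure Dominates (G : SimpleGraph V) (p q a₀ : V) : Prop where
  adj : ∀ ⦃c x y c' x' y'⦄, c ≠ a₀ → Stem G p c x y → Stem G p c' x' y' → y ≠ y' → G.Adj y y'
  not_adj : ∀ ⦃z z' c x y c' x' y'⦄, Outer G p q z → Outer G p q z' → c ≠ a₀ → c' ≠ a₀ →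
    Stem G p c x y → Stem G p c' x' y' → y ≠ z → ¬ G.Adj y z → y' ≠ z' → ¬ G.Adj y' z' →
    ¬ G.Adj z z'

/-- All bad pairs are reached through the single edge `x₀ y₀`. -/
structure Bottleneck (G : SimpleGraph V) (p q x₀ y₀ : V) : Prop where
  adj : ∀ ⦃c x y c' x' y'⦄, Stem G p c x y → Stem G p c' x' y' → y ≠ y' → G.Adj y y'
  eq : ∀ ⦃c x⦄, Stem G p c x y₀ → x = x₀
  not_adj : ∀ ⦃z z' c x y c' x' y'⦄, Outer G p q z → Outer G p q z' → y ≠ y₀ → y' ≠ y₀ →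
    Stem G p c x y → Stem G p c' x' y' → y ≠ z → ¬ G.Adj y z → y' ≠ z' → ¬ G.Adj y' z' →
    ¬ G.Adj z z'

/-- `x₀` misses only `a₀` and is adjacent to the end of every stem that avoids `a₀`. -/
structure Blossom (G : SimpleGraph V) (p a₀ x₀ : V) : Prop where
  misses : Misses G p a₀ x₀
  eq : ∀ ⦃c⦄, Misses G p c x₀ → c = a₀
  adj : ∀ ⦃c x y⦄, c ≠ a₀ → Stem G p c x y → G.Adj x₀ y

/-- All stems to y₁ and y₂ use one neighbour of p, since any two of them, one to each end, must
agree. Stems avoiding it are therefore disjoint enough from these for `adj_of_nonedge`. -/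
theorem blossom_of_nonedge (h : NoShortTrail G p q) (hX : MissersIndep G p)
    {a₁ a₂ x₁ x₂ y₁ y₂ : V} (h₁ : Stem G p a₁ x₁ y₁) (h₂ : Stem G p a₂ x₂ y₂) (hne : y₁ ≠ y₂)
    (hn : ¬ G.Adj y₁ y₂) : Blossom G p a₂ x₂ := by
  have o₁ := h.outer_of_stem hX h₁
  have o₂ := h.outer_of_stem hX h₂
  have key : ∀ {c c' x x'}, Stem G p c x y₁ → Stem G p c' x' y₂ → c = c' := fun s t =>
    h.eq_of_nonedge s.1 s.2.1 o₁ hne hn o₂ t.2.1 t.1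
  obtain rfl := key h₁ h₂
  refine ⟨h₂.1, fun c hc => (key h₁ ⟨hc, h₂.2⟩).symm, fun c x y hc hs => ?_⟩
  refine h.adj_of_nonedge h₁.1 h₁.2.1 o₁ hne hn h₂.1 h₂.2.1 o₂ hs.1 hs.2.1
    (h.outer_of_stem hX hs) hc.symm ⟨?_, ?_⟩ ⟨?_, ?_⟩
  · rintro rfl; exact hc (key hs h₂)
  · rintro rfl; exact hc (key h₁ hs).symm
  · rintro rfl; exact hc (key ⟨hs.1, h₁.2⟩ h₂)
  · rintro rfl; exact hc (key h₁ ⟨hs.1, h₂.2⟩).symm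

theorem blossom_of_outer_edge (h : NoShortTrail G p q) (hX : MissersIndep G p)
    {a₁ a₂ x₁ x₂ y₁ y₂ z₁ z₂ : V} (h₁ : Stem G p a₁ x₁ y₁) (h₂ : Stem G p a₂ x₂ y₂)
    (hne : y₁ ≠ y₂) (hz₁ : Outer G p q z₁) (hz₂ : Outer G p q z₂) (hyz₁ : y₁ ≠ z₁)
    (hyz₁' : ¬ G.Adj y₁ z₁) (hyz₂ : y₂ ≠ z₂) (hyz₂' : ¬ G.Adj y₂ z₂) (hzz : G.Adj z₁ z₂) :
    Blossom G p a₂ x₂ := by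
  have o₁ := h.outer_of_stem hX h₁
  have o₂ := h.outer_of_stem hX h₂
  have key : ∀ {c c' x x'}, Stem G p c x y₁ → Stem G p c' x' y₂ → c = c' := fun s t =>
    h.eq_of_outer_edge s.1 s.2.1 o₁ hyz₁ hyz₁' hz₁ hzz hz₂ hyz₂.symm (fun e => hyz₂' e.symm) o₂
      t.2.1 t.1 (.inr hne)
  obtain rfl := key h₁ h₂
  refine ⟨h₂.1, fun c hc => (key h₁ ⟨hc, h₂.2⟩).symm, fun c x y hc hs => ?_⟩
  refine h.adj_of_outer_edge h₁.1 h₁.2.1 o₁ ⟨hyz₁, hyz₁'⟩ hz₁ hzz hz₂ ⟨hyz₂, hyz₂'⟩ hne h₂.1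
    h₂.2.1 o₂ hs.1 hs.2.1 (h.outer_of_stem hX hs) hc.symm ⟨?_, ?_⟩ ⟨?_, ?_⟩
  · rintro rfl; exact hc (key hs h₂)
  · rintro rfl; exact hc (key h₁ hs).symm
  · rintro rfl; exact hc (key ⟨hs.1, h₁.2⟩ h₂)
  · rintro rfl; exact hc (key h₁ ⟨hs.1, h₂.2⟩).symm

/-- The end of a stem that avoids a₀ is also reached through a₀ and x₀. An obstruction there would
force its other stem to use two different neighbours of p. -/
theorem Blossom.dominates (h : NoShortTrail G p q) (hX : MissersIndep G p) {a₀ x₀ : V}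
    (hb : Blossom G p a₀ x₀) : Dominates G p q a₀ := by
  constructor
  · intro c x y c' x' y' hc hs hs' hne
    by_contra hn
    have o := h.outer_of_stem hX hs
    have o' := h.outer_of_stem hX hs'
    have e₁ := h.eq_of_nonedge hs.1 hs.2.1 o hne hn o' hs'.2.1 hs'.1
    have e₂ := h.eq_of_nonedge hb.misses (hb.adj hc hs) o hne hn o' hs'.2.1 hs'.1
    exact hc (e₁.trans e₂.symm)
  · intro z z' c x y c' x' y' hz hz' hc hc' hs hs' hyz hyz' hyz₂ hyz₂' hzz
    have o := h.outer_of_stem hX hs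
    have o' := h.outer_of_stem hX hs'
    refine hc' (h.eq_of_outer_edge hb.misses (hb.adj hc hs) o hyz hyz' hz hzz hz' hyz₂.symm
      (fun e => hyz₂' e.symm) o' hs'.2.1 hs'.1 (.inl ?_)).symm
    rintro rfl
    exact hc' (hb.eq hs'.1)

theorem dominates_or_bottleneck (h : NoShortTrail G p q) (hX : MissersIndep G p) :
    (∃ a₀, Dominates G p q a₀) ∨ ∃ x₀ y₀, Bottleneck G p q x₀ y₀ := by
  by_cases hb : ∃ a₀ x₀, Blossom G p a₀ x₀
  · obtain ⟨a₀, x₀, hb⟩ := hb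
    exact .inl ⟨a₀, hb.dominates h hX⟩
  have hadj : ∀ ⦃c x y c' x' y'⦄, Stem G p c x y → Stem G p c' x' y' → y ≠ y' → G.Adj y y' := by
    intro c x y c' x' y' hs hs' hne
    by_contra hn
    exact hb ⟨_, _, h.blossom_of_nonedge hX hs hs' hne hn⟩
  have heq : ∀ ⦃z z' c x y c' x' y'⦄, Outer G p q z → Outer G p q z' →
      Stem G p c x y → Stem G p c' x' y' → y ≠ z → ¬ G.Adj y z → y' ≠ z' → ¬ G.Adj y' z' →
      G.Adj z z' → y = y' := by
    intro z z' c x y c' x' y' hz hz' hs hs' e₁ e₂ e₃ e₄ hzz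
    by_contra hne
    exact hb ⟨_, _, h.blossom_of_outer_edge hX hs hs' hne hz hz' e₁ e₂ e₃ e₄ hzz⟩
  by_cases hbad : ∃ z z' c x y, Outer G p q z ∧ Outer G p q z' ∧ Stem G p c x y ∧ (y ≠ z ∧
      ¬ G.Adj y z) ∧ (y ≠ z' ∧ ¬ G.Adj y z') ∧ G.Adj z z'
  swap
  -- No obstruction is left, so any vertex serves as a₀; p is a dummy.
  · refine .inl ⟨p, fun _ _ _ _ _ _ _ => @hadj _ _ _ _ _ _, ?_⟩
    intro z z' c x y c' x' y' hz hz' _ _ hs hs' e₁ e₂ e₃ e₄ hzz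
    obtain rfl := heq hz hz' hs hs' e₁ e₂ e₃ e₄ hzz
    exact hbad ⟨z, z', c, x, y, hz, hz', hs, ⟨e₁, e₂⟩, ⟨e₃, e₄⟩, hzz⟩
  obtain ⟨z₁, z₁', a₁, x₁, y₁, hz₁, hz₁', hs₁, hy₁, hy₁', hzz₁⟩ := hbad
  have o₁ := h.outer_of_stem hX hs₁
  -- A second obstructed end y must be adjacent to nothing that y₁ misses in its own edge, so y₁ is
  -- joined to z, and the detour at y₁ continues to y: all stems to y₁ share the neighbour used by
  -- y.
  have hother : ∀ ⦃z z' c x y c' x' y'⦄, Outer G p q z → Outer G p q z' → y ≠ y₁ →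
      Stem G p c x y → Stem G p c' x' y' → y ≠ z → ¬ G.Adj y z → y' ≠ z' → ¬ G.Adj y' z' →
      G.Adj z z' → ∀ ⦃b w⦄, Stem G p b w y₁ → b = c := by
    intro z z' c x y c' x' y' hz hz' hne hs hs' e₁ e₂ e₃ e₄ hzz b w hb'
    obtain rfl := heq hz hz' hs hs' e₁ e₂ e₃ e₄ hzz
    have hy₁z : G.Adj y₁ z := by
      by_contra hn
      by_cases hyz : y₁ = z
      · subst hyz
        exact e₂ (hadj hs hs₁ hne)
      · exact hne (heq hz hz' hs₁ hs hyz hn e₃ e₄ hzz).symm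
    exact h.eq_of_two_outer_edges hb'.1 hb'.2.1 o₁ hy₁ hz₁ hzz₁ hz₁' hy₁' hy₁z hz ⟨e₁, e₂⟩
      hne.symm (h.outer_of_stem hX hs) hs.2.1 hs.1
  by_cases hdom : ∀ c x, Stem G p c x y₁ → c = a₁
  · refine .inl ⟨a₁, fun _ _ _ _ _ _ _ => @hadj _ _ _ _ _ _, ?_⟩
    intro z z' c x y c' x' y' hz hz' hc _ hs hs' e₁ e₂ e₃ e₄ hzz
    have hne : y ≠ y₁ := by
      rintro rfl
      exact hc (hdom c x hs)
    exact hc (hother hz hz' hne hs hs' e₁ e₂ e₃ e₄ hzz hs₁).symm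
  · push Not at hdom
    obtain ⟨a₂, x₂, hs₂, ha₂⟩ := hdom
    -- Stems to y₁ through different neighbours of p and different x would be linked by the detour
    -- at y₁. As two neighbours occur, every stem to y₁ passes through the same x₂.
    have key : ∀ {c c' x x'}, Stem G p c x y₁ → Stem G p c' x' y₁ → c ≠ c' → x = x' := by
      intro c c' x x' s t hc
      by_contra hx
      exact hc (h.eq_of_outer_edge s.1 s.2.1 o₁ hy₁.1 hy₁.2 hz₁ hzz₁ hz₁' hy₁'.1.symm
        (fun e => hy₁'.2 e.symm) o₁ t.2.1 t.1 (.inl hx))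
    obtain rfl := key hs₂ hs₁ ha₂
    refine .inr ⟨x₂, y₁, hadj, fun c x hs => ?_, ?_⟩
    · by_cases hc : c = a₁
      · exact key hs hs₂ (hc ▸ ha₂.symm)
      · exact key hs hs₁ hc
    · intro z z' c x y c' x' y' hz hz' hy _ hs hs' e₁ e₂ e₃ e₄ hzz
      have := hother hz hz' hy hs hs' e₁ e₂ e₃ e₄ hzz
      exact ha₂ ((this hs₂).trans (this hs₁).symm)

end NoShortTrail

end Dichotomy

/-! ### Building the saturated pair in each case -/

section Main

variable {n S c₁ c₂ : ℕ}

theorem adjPairs_le_one {V : Type*} {G : SimpleGraph V} {U T : Finset V} (u₀ t₀ : V)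
    (h : ∀ u ∈ U, ∀ t ∈ T, G.Adj u t → u = u₀ ∧ t = t₀) : adjPairs G U T ≤ 1 := by
  classical
  calc adjPairs G U T ≤ ∑ u ∈ U, ∑ t ∈ T, if u = u₀ then (if t = t₀ then 1 else 0) else 0 := by
        refine Finset.sum_le_sum fun u hu => Finset.sum_le_sum fun t ht => ?_
        by_cases hut : G.Adj u t
        · obtain ⟨rfl, rfl⟩ := h u hu t ht hut
          simp [hut]
        · simp [hut]
    _ ≤ 1 := by
        simp only [Finset.sum_ite_irrel, Finset.sum_ite_eq', Finset.sum_const_zero]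
        split_ifs <;> simp

open scoped Classical in
/-- The set `Z` of `no_saturated_pair` may be taken to consist of `X` and the vertices outside `Y`
that are not adjacent to all of `Y`. -/
theorem no_saturated_clique (hc₂ : 0 < c₂) (hc : c₂ ≤ c₁) (hn : c₁ < n)
    (hfull : FullyGraphic (simpleRegion n S c₁ c₂))
    {D : Fin n → ℕ} (hD : D ∈ simpleRegion n S c₁ c₂) {p q : Fin n} {G : SimpleGraph (Fin n)}
    (hG : Realizes G (perturb D p q)) {A X Y : Finset (Fin n)}
    (hAY : A ⊆ Y) (hXY : ∀ x ∈ X, x ∉ Y)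
    (hY : ∀ u ∈ Y, ∀ v ∈ Y, u ≠ v → G.Adj u v) (hX : ∀ u ∈ X, ∀ v ∈ X, ¬ G.Adj u v)
    (hXZ : ∀ u ∈ X, ∀ v, v ∉ X → v ∉ Y → ∀ y ∈ Y, ¬ G.Adj y v → ¬ G.Adj u v)
    (hZ : ∀ u v, u ∉ X → v ∉ X → u ∉ Y → v ∉ Y → ∀ y ∈ Y, ∀ y' ∈ Y,
      ¬ G.Adj y u → ¬ G.Adj y' v → ¬ G.Adj u v)
    (hAX : ∀ a ∈ A, ∀ v, v ∉ Y → v ∉ X → G.Adj a v)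
    (hdef : adjPairs G X Yᶜ ≤ 1) (hp : p ∈ X) (hq : q ∈ X)
    (hcard : c₂ ≤ A.card) (hpA : ∀ a ∈ A, G.Adj p a) : False := by
  obtain ⟨a, ha⟩ := Finset.card_pos.1 (hc₂.trans_le hcard)
  refine no_saturated_pair hc₂ hc hn hfull hD hG (Y := Y)
    (Z := Finset.univ.filter fun v => v ∈ X ∨ v ∉ Y ∧ ∃ y ∈ Y, ¬ G.Adj y v) hAY
    (fun x hx => by simp [hx]) ?_ hY ?_ hAX ?_ hdef hp hq hcard ha (hpA a ha)
  · refine Finset.disjoint_left.2 fun y hy hyZ => ?_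
    simp only [Finset.mem_filter, Finset.mem_univ, true_and] at hyZ
    rcases hyZ with hx | hx
    · exact hXY y hx hy
    · exact hx.1 hy
  · intro u hu v hv huv
    simp only [Finset.mem_filter, Finset.mem_univ, true_and] at hu hv
    by_cases hu' : u ∈ X <;> by_cases hv' : v ∈ X
    · exact hX u hu' v hv' huv
    · obtain ⟨hvY, y, hy, hyv⟩ := hv.resolve_left hv'
      exact hXZ u hu' v hv' hvY y hy hyv huv
    · obtain ⟨huY, y, hy, hyu⟩ := hu.resolve_left hu'
      exact hXZ v hv' u hu' huY y hy hyu huv.symm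
    · obtain ⟨hvY, y', hy', hyv⟩ := hv.resolve_left hv'
      obtain ⟨huY, y, hy, hyu⟩ := hu.resolve_left hu'
      exact hZ u v hu' hv' huY hvY y hy y' hy' hyu hyv huv
  · intro y hy v hv hvZ
    simp only [Finset.mem_filter, Finset.mem_univ, true_and, not_or, not_and, not_exists,
      not_not] at hvZ
    exact hvZ.2 hv y hy

theorem not_adj_twins {V : Type*} {G : SimpleGraph V} {p q : V}
    (h : ∀ v, G.Adj p v ↔ G.Adj q v) {u v : V} (hu : u = p ∨ u = q) (hv : v = p ∨ v = q) :
    ¬ G.Adj u v := by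
  intro huv
  have h1 : G.Adj p v := by
    rcases hu with rfl | rfl
    · exact huv
    · exact (h v).2 huv
  rcases hv with rfl | rfl
  · exact G.irrefl h1
  · exact G.irrefl ((h _).1 h1)

open scoped Classical in
/-- The case where the vertices missing some neighbour of `p` are independent. -/
theorem false_of_missersIndep (hc₂ : 0 < c₂) (hc : c₂ ≤ c₁) (hn : c₁ < n)
    (hfull : FullyGraphic (simpleRegion n S c₁ c₂))
    {D : Fin n → ℕ} (hD : D ∈ simpleRegion n S c₁ c₂) {p q : Fin n} {G : SimpleGraph (Fin n)}
    (hG : Realizes G (perturb D p q)) (h : NoShortTrail G p q) (hI : MissersIndep G p)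
    (P Q : Fin n → Prop)
    (hcard : c₂ ≤ (Finset.univ.filter fun v => G.Adj p v ∧ P v).card)
    (hQ : ∀ y, Q y → ∃ c x, Stem G p c x y)
    (hadj : ∀ y, Q y → ∀ c x y', Stem G p c x y' → y ≠ y' → G.Adj y y')
    (hnadj : ∀ z z' y y', Outer G p q z → Outer G p q z' → Q y → Q y' →
      y ≠ z → ¬ G.Adj y z → y' ≠ z' → ¬ G.Adj y' z' → ¬ G.Adj z z')
    (hdef : adjPairs G (Finset.univ.filter fun v => (v = p ∨ v = q) ∨ ∃ a, P a ∧ Misses G p a v)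
      (Finset.univ.filter fun v => G.Adj p v ∨ Q v)ᶜ ≤ 1) : False := by
  have hout : ∀ y, Q y → Outer G p q y := fun y hy => by
    obtain ⟨c, x, hs⟩ := hQ y hy
    exact h.outer_of_stem hI hs
  have htwin : ∀ {u v}, (u = p ∨ u = q) → G.Adj u v → G.Adj p v := by
    rintro u v (rfl | rfl) huv
    · exact huv
    · exact (h.adj_iff v).2 huv
  refine no_saturated_clique hc₂ hc hn hfull hD hG ?_ ?_ ?_ ?_ ?_ ?_ ?_ hdef ?_ ?_ hcard ?_ <;>
    try simp only [Finset.mem_filter, Finset.mem_univ, true_and]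
  · intro a ha
    simp only [Finset.mem_filter, Finset.mem_univ, true_and] at ha ⊢
    exact .inl ha.1
  · rintro x (hx | ⟨a, -, hx⟩) (hpx | hx')
    · exact not_adj_twins h.adj_iff (.inl rfl) hx hpx
    · have := hout x hx'
      exact hx.elim this.1 this.2.1
    · exact (h.misses_facts hx).2.2.2 hpx
    · exact hx.2.2 ((hout x hx').2.2.2 a hx.1)
  · rintro u (hu | hu) v (hv | hv) huv
    · exact h.adj_of_adj hu hv huv
    · exact (hout v hv).2.2.2 u hu
    · exact ((hout u hu).2.2.2 v hv).symm
    · obtain ⟨c, x, hs⟩ := hQ v hv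
      exact hadj u hu c x v hs huv
  · rintro u (hu | ⟨a, -, hu⟩) v (hv | ⟨b, -, hv⟩) huv
    · exact not_adj_twins h.adj_iff hu hv huv
    · exact (h.misses_facts hv).2.2.2 (htwin hu huv)
    · exact (h.misses_facts hu).2.2.2 (htwin hv huv.symm)
    · exact hI hu hv huv
  · rintro u (hu | ⟨a, -, hu⟩) v - hvY y hy hyv huv
    · exact hvY (.inl (htwin hu huv))
    · have hs : Stem G p a u v := ⟨hu, huv, fun e => hvY (.inl e)⟩
      rcases hy with hy | hy
      · exact hyv ((h.outer_of_stem hI hs).2.2.2 y hy)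
      · refine hyv (hadj y hy a u v hs ?_)
        rintro rfl
        exact hvY (.inr hy)
  -- A neighbour v of a misser, if outside N, is a stem end, hence complete to Y and not in Z. So an
  -- edge within Z outside X can only join two outer vertices, where `hnadj` applies.
  · have key : ∀ u v, ¬ (G.Adj p v ∨ Q v) → ∀ y', (G.Adj p y' ∨ Q y') →
        ¬ G.Adj y' v → (∃ a, Misses G p a u) → ¬ G.Adj u v := by
      rintro u v hvY y' hy' hyv ⟨a, hu⟩ huv
      have hs : Stem G p a u v := ⟨hu, huv, fun e => hvY (.inl e)⟩
      rcases hy' with hy' | hy'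
      · exact hyv ((h.outer_of_stem hI hs).2.2.2 y' hy')
      · refine hyv (hadj y' hy' a u v hs ?_)
        rintro rfl
        exact hvY (.inr hy')
    intro u v hu hv huY hvY y hy y' hy' hyu hyv huv
    by_cases hmu : ∃ a, Misses G p a u
    · exact key u v hvY y' hy' hyv hmu huv
    by_cases hmv : ∃ a, Misses G p a v
    · exact key v u huY y hy hyu hmv huv.symm
    push Not at hmu hmv
    rw [not_or, not_or] at hu hv
    have ou := Outer.of_forall hu.1.1 hu.1.2 (fun e => huY (.inl e)) hmu
    have ov := Outer.of_forall hv.1.1 hv.1.2 (fun e => hvY (.inl e)) hmv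
    have hy₁ : Q y := hy.resolve_left fun e => hyu (ou.2.2.2 y e)
    have hy₂ : Q y' := hy'.resolve_left fun e => hyv (ov.2.2.2 y' e)
    refine hnadj u v y y' ou ov hy₁ hy₂ ?_ hyu ?_ hyv huv
    · rintro rfl; exact huY (.inr hy₁)
    · rintro rfl; exact hvY (.inr hy₂)
  · rintro a ⟨ha, hPa⟩ v hvY hvX
    by_contra hn
    refine hvX (.inr ⟨a, hPa, ha, ?_, hn⟩)
    rintro rfl
    exact hvY (.inl ha)
  · exact .inl (.inl trivial)
  · exact .inl (.inr trivial)
  · exact fun a ha => ha.1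

open scoped Classical in
theorem le_card_filter_adj {D : Fin n → ℕ} (hD : D ∈ simpleRegion n S c₁ c₂) {p q : Fin n}
    {G : SimpleGraph (Fin n)} (hG : Realizes G (perturb D p q)) :
    c₂ + 1 ≤ (Finset.univ.filter fun v => G.Adj p v).card := by
  have h1 := hG.adjPairs_singleton_univ p
  have h2 := perturb_apply D p q p
  have h3 := (hD.2.1 p).1
  simp only [adjPairs, Finset.sum_singleton] at h1
  rw [Finset.card_filter, h1, h2]
  simp only [if_true]
  omega

-- The unit added at p pays for discarding a₀.
open scoped Classical in
theorem le_card_filter_adj_ne {D : Fin n → ℕ} (hD : D ∈ simpleRegion n S c₁ c₂) {p q : Fin n}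
    {G : SimpleGraph (Fin n)} (hG : Realizes G (perturb D p q)) (a₀ : Fin n) :
    c₂ ≤ (Finset.univ.filter fun v => G.Adj p v ∧ v ≠ a₀).card := by
  have h1 := le_card_filter_adj hD hG
  have h2 : (Finset.univ.filter fun v => G.Adj p v ∧ v ≠ a₀)
      = (Finset.univ.filter fun v => G.Adj p v).erase a₀ := by
    ext v
    simp [and_comm]
  have h3 := Finset.pred_card_le_card_erase (s := Finset.univ.filter fun v => G.Adj p v) (a := a₀)
  rw [h2]
  omega

theorem false_of_dominates (hc₂ : 0 < c₂) (hc : c₂ ≤ c₁) (hn : c₁ < n)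
    (hfull : FullyGraphic (simpleRegion n S c₁ c₂))
    {D : Fin n → ℕ} (hD : D ∈ simpleRegion n S c₁ c₂) {p q : Fin n} {G : SimpleGraph (Fin n)}
    (hG : Realizes G (perturb D p q)) (h : NoShortTrail G p q) (hI : MissersIndep G p)
    {a₀ : Fin n} (hd : NoShortTrail.Dominates G p q a₀) : False := by
  classical
  refine false_of_missersIndep hc₂ hc hn hfull hD hG h hI (fun a => a ≠ a₀)
    (fun y => ∃ c x, c ≠ a₀ ∧ Stem G p c x y) ?_ ?_ ?_ ?_ ?_
  · convert le_card_filter_adj_ne hD hG a₀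
  · rintro y ⟨c, x, -, hs⟩
    exact ⟨c, x, hs⟩
  · rintro y ⟨c, x, hca, hs⟩ c' x' y' hs' hne
    exact hd.adj hca hs hs' hne
  · rintro z z' y y' hz hz' ⟨c, x, hca, hs⟩ ⟨c', x', hca', hs'⟩ e₁ e₂ e₃ e₄
    exact hd.not_adj hz hz' hca hca' hs hs' e₁ e₂ e₃ e₄
  -- There are no such pairs at all, so p, p are dummies: a neighbour of X outside N ends a stem
  -- avoiding a₀.
  · refine adjPairs_le_one p p fun u hu t ht hut => ?_
    simp only [Finset.mem_filter, Finset.mem_univ, true_and, Finset.mem_compl, not_or] at hu ht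
    rcases hu with hu | ⟨a, ha, hu⟩
    · refine absurd ?_ ht.1
      rcases hu with rfl | rfl
      · exact hut
      · exact (h.adj_iff t).2 hut
    · exact absurd ⟨a, u, ha, hu, hut, ht.1⟩ ht.2

theorem false_of_bottleneck (hc₂ : 0 < c₂) (hc : c₂ ≤ c₁) (hn : c₁ < n)
    (hfull : FullyGraphic (simpleRegion n S c₁ c₂))
    {D : Fin n → ℕ} (hD : D ∈ simpleRegion n S c₁ c₂) {p q : Fin n} {G : SimpleGraph (Fin n)}
    (hG : Realizes G (perturb D p q)) (h : NoShortTrail G p q) (hI : MissersIndep G p)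
    {x₀ y₀ : Fin n} (hd : NoShortTrail.Bottleneck G p q x₀ y₀) : False := by
  classical
  refine false_of_missersIndep hc₂ hc hn hfull hD hG h hI (fun _ => True)
    (fun y => y ≠ y₀ ∧ ∃ c x, Stem G p c x y) ?_ ?_ ?_ ?_ ?_
  · have := le_card_filter_adj hD hG
    simp only [and_true]
    convert (Nat.le_succ c₂).trans this
  · exact fun y hy => hy.2
  · rintro y ⟨-, c, x, hs⟩ c' x' y' hs' hne
    exact hd.adj hs hs' hne
  · rintro z z' y y' hz hz' ⟨hy, c, x, hs⟩ ⟨hy', c', x', hs'⟩ e₁ e₂ e₃ e₄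
    exact hd.not_adj hz hz' hy hy' hs hs' e₁ e₂ e₃ e₄
  -- Only y₀ was removed from the stem ends, and every stem to it comes from x₀; this uses up the
  -- permitted defect.
  · refine adjPairs_le_one x₀ y₀ fun u hu t ht hut => ?_
    simp only [Finset.mem_filter, Finset.mem_univ, true_and, Finset.mem_compl, not_or] at hu ht
    rcases hu with hu | ⟨a, hu⟩
    · refine absurd ?_ ht.1
      rcases hu with rfl | rfl
      · exact hut
      · exact (h.adj_iff t).2 hut
    · have hs : Stem G p a u t := ⟨hu, hut, ht.1⟩
      have ht₀ : t = y₀ := by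
        by_contra hne
        exact ht.2 ⟨hne, a, u, hs⟩
      subst ht₀
      exact ⟨hd.eq hs, rfl⟩

/-- The case where two adjacent vertices miss the same neighbour `a` of `p`. -/
theorem false_of_triangle (hc₂ : 0 < c₂) (hc : c₂ ≤ c₁) (hn : c₁ < n)
    (hfull : FullyGraphic (simpleRegion n S c₁ c₂))
    {D : Fin n → ℕ} (hD : D ∈ simpleRegion n S c₁ c₂) {p : Fin n} {G : SimpleGraph (Fin n)}
    (hG : Realizes G (perturb D p p)) (h : NoShortTrail G p p) {a x₁ x₂ : Fin n}
    (hx₁ : Misses G p a x₁) (hx₂ : Misses G p a x₂) (hxx : G.Adj x₁ x₂) : False := by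
  classical
  -- Every stem avoiding a can thus be rerouted through a, so an obstruction would force equality
  -- with both a and c.
  have hboth : ∀ {c x}, c ≠ a → Misses G p c x → Misses G p a x := fun {c x} hca hx =>
    ⟨hx₁.1, fun e => (h.misses_facts hx).2.2.2 (e ▸ hx₁.1),
      h.not_adj_of_triangle hx₁ hxx hx₂ hx hca.symm⟩
  have hindep : ∀ {c c' x x'}, c ≠ a → Misses G p c x → Misses G p c' x' → ¬ G.Adj x x' := by
    intro c c' x x' hca hx hx' hadj
    have e₁ := (h.eq_of_edge hx hadj hx').1
    have e₂ := (h.eq_of_edge (hboth hca hx) hadj hx').1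
    exact hca (e₁.trans e₂.symm)
  have hout : ∀ {c x y}, c ≠ a → Stem G p c x y → Outer G p p y := by
    intro c x y hca hs
    have hx := (h.misses_facts hs.1).2.2.2
    refine Outer.of_forall ?_ ?_ hs.2.2 fun b hb => hindep hca hs.1 hb hs.2.1
    · rintro rfl; exact hx hs.2.1.symm
    · rintro rfl; exact hx hs.2.1.symm
  refine no_saturated_clique hc₂ hc hn hfull hD hG
    (A := Finset.univ.filter fun v => G.Adj p v ∧ v ≠ a)
    (X := Finset.univ.filter fun v => v = p ∨ ∃ c, c ≠ a ∧ Misses G p c v)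
    (Y := Finset.univ.filter fun v => (G.Adj p v ∧ v ≠ a) ∨ ∃ c x, c ≠ a ∧ Stem G p c x v)
    ?_ ?_ ?_ ?_ ?_ ?_ ?_ ?_ ?_ ?_ ?_ ?_ <;>
    try simp only [Finset.mem_filter, Finset.mem_univ, true_and]
  · intro v hv
    simp only [Finset.mem_filter, Finset.mem_univ, true_and] at hv ⊢
    exact .inl hv
  · rintro x (rfl | ⟨c, hca, hx⟩) (⟨hpx, -⟩ | ⟨c', x', hca', hs⟩)
    · exact G.irrefl hpx
    · exact (hout hca' hs).1 rfl
    · exact (h.misses_facts hx).2.2.2 hpx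
    · exact hx.2.2 ((hout hca' hs).2.2.2 c hx.1)
  · rintro u (⟨hu, -⟩ | ⟨c, x, hca, hs⟩) v (⟨hv, -⟩ | ⟨c', x', hca', hs'⟩) huv
    · exact h.adj_of_adj hu hv huv
    · exact (hout hca' hs').2.2.2 u hu
    · exact ((hout hca hs).2.2.2 v hv).symm
    · by_contra hn
      exact hca' (h.eq_of_nonedge (hboth hca hs.1) hs.2.1 (hout hca hs) huv hn (hout hca' hs')
        hs'.2.1 hs'.1).symm
  · rintro u (rfl | ⟨c, hca, hu⟩) v (rfl | ⟨c', hca', hv⟩) huv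
    · exact G.irrefl huv
    · exact (h.misses_facts hv).2.2.2 huv
    · exact (h.misses_facts hu).2.2.2 huv.symm
    · exact hindep hca hu hv huv
  · rintro u (rfl | ⟨c, hca, hu⟩) v - hvY y hy hyv huv
    · have hva : v = a := by
        by_contra hne
        exact hvY (.inl ⟨huv, hne⟩)
      subst hva
      rcases hy with ⟨hy, hya⟩ | ⟨c, x, hca, hs⟩
      · exact hyv (h.adj_of_adj hy huv hya)
      · exact hyv ((hout hca hs).2.2.2 v huv).symm
    · have hpv : ¬ G.Adj p v := fun e => by
        refine hvY (.inl ⟨e, ?_⟩)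
        rintro rfl
        exact (hboth hca hu).2.2 huv.symm
      exact hvY (.inr ⟨c, u, hca, hu, huv, hpv⟩)
  · have hstem : ∀ u, ¬ (u = p ∨ ∃ c, c ≠ a ∧ Misses G p c u) →
        ¬ ((G.Adj p u ∧ u ≠ a) ∨ ∃ c x, c ≠ a ∧ Stem G p c x u) → ∀ y,
        ((G.Adj p y ∧ y ≠ a) ∨ ∃ c x, c ≠ a ∧ Stem G p c x y) → ¬ G.Adj y u →
        (∃ c x, c ≠ a ∧ Stem G p c x y) ∧ ¬ G.Adj p u := by
      rintro u hu huY y hy hyu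
      have hs : ∃ c x, c ≠ a ∧ Stem G p c x y := by
        refine hy.resolve_left fun ⟨e₁, e₂⟩ => hu (.inr ⟨y, e₂, e₁, ?_, hyu⟩)
        rintro rfl
        exact huY (.inl ⟨e₁, e₂⟩)
      refine ⟨hs, fun e => ?_⟩
      obtain ⟨c, x, hca, hs⟩ := hs
      exact hyu ((hout hca hs).2.2.2 u e).symm
    intro u v hu hv huY hvY y hy y' hy' hyu hyv huv
    obtain ⟨⟨c, x, hca, hs⟩, hpu⟩ := hstem u hu huY y hy hyu
    obtain ⟨⟨c', x', hca', hs'⟩, hpv⟩ := hstem v hv hvY y' hy' hyv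
    have hyu' : y ≠ u := by rintro rfl; exact huY hy
    have hyv' : y' ≠ v := by rintro rfl; exact hvY hy'
    have ou : Outer G p p u := by
      rw [not_or] at hu
      refine Outer.of_forall hu.1 hu.1 hpu fun b hb => ?_
      have hba : b = a := by
        by_contra hne
        exact hu.2 ⟨b, hne, hb⟩
      subst hba
      refine h.false_of_misses hb huv hyv'.symm (fun e => hyv e.symm) (hout hca' hs') hs'.2.1
        hs'.1 hca'.symm ?_
      rintro rfl
      exact hu.2 ⟨c', hca', hs'.1⟩
    have ov : Outer G p p v := by
      rw [not_or] at hv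
      refine Outer.of_forall hv.1 hv.1 hpv fun b hb => ?_
      have hba : b = a := by
        by_contra hne
        exact hv.2 ⟨b, hne, hb⟩
      subst hba
      refine h.false_of_misses hb huv.symm hyu'.symm (fun e => hyu e.symm) (hout hca hs) hs.2.1
        hs.1 hca.symm ?_
      rintro rfl
      exact hv.2 ⟨c, hca, hs.1⟩
    by_cases hyy : y = y'
    · subst hyy
      exact h.false_of_triangle hx₁ hxx hx₂ (hout hca hs) ⟨hyu', hyu⟩ ou huv ov ⟨hyv', hyv⟩
        hs.2.1 hs.1 hca.symm
    · exact hca' (h.eq_of_outer_edge (hboth hca hs.1) hs.2.1 (hout hca hs) hyu' hyu ou huv ov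
        hyv'.symm (fun e => hyv e.symm) (hout hca' hs') hs'.2.1 hs'.1 (.inr hyy)).symm
  · rintro b ⟨hb, hba⟩ v hvY hvX
    by_contra hn
    refine hvX (.inr ⟨b, hba, hb, ?_, hn⟩)
    rintro rfl
    exact hvY (.inl ⟨hb, hba⟩)
  -- The vertex a is left out of Y because its nonneighbours x₁, x₂ are adjacent; the edge pa is the
  -- whole defect.
  · refine adjPairs_le_one p a fun u hu t ht hut => ?_
    simp only [Finset.mem_filter, Finset.mem_univ, true_and, Finset.mem_compl, not_or] at hu ht
    rcases hu with rfl | ⟨c, hca, hu⟩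
    · refine ⟨rfl, ?_⟩
      by_contra hne
      exact ht.1 ⟨hut, hne⟩
    · have hpt : ¬ G.Adj p t := fun e => by
        refine ht.1 ⟨e, ?_⟩
        rintro rfl
        exact (hboth hca hu).2.2 hut.symm
      exact absurd ⟨c, u, hca, hu, hut, hpt⟩ ht.2
  · exact .inl trivial
  · exact .inl trivial
  · exact le_card_filter_adj_ne hD hG a
  · exact fun b hb => hb.1

end Main

end DegSeq

theorem theorem2p3 (n S c₁ c₂ : ℕ) (hc₂ : 0 < c₂) (hc : c₂ ≤ c₁) (hn : c₁ < n)
    (hfull : DegSeq.FullyGraphic (DegSeq.simpleRegion n S c₁ c₂))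
    (D : Fin n → ℕ) (hD : D ∈ DegSeq.simpleRegion n S c₁ c₂)
    (p q : Fin n) (G : SimpleGraph (Fin n))
    (hG : DegSeq.Realizes G (DegSeq.perturb D p q))
    (hpq : G.neighborSet p = G.neighborSet q) :
    ∃ w : (⊤ : SimpleGraph (Fin n)).Walk p q, DegSeq.IsWitnessTrail G 11 w := by
  by_contra hno
  have h : DegSeq.NoShortTrail G p q :=
    ⟨fun v => by rw [← SimpleGraph.mem_neighborSet, hpq, SimpleGraph.mem_neighborSet],
      fun l hl ha hE hO => hno (ha.exists_isWitnessTrail hl hE hO)⟩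
  by_cases hI : DegSeq.MissersIndep G p
  · rcases h.dominates_or_bottleneck hI with ⟨a₀, hd⟩ | ⟨x₀, y₀, hd⟩
    · exact DegSeq.false_of_dominates hc₂ hc hn hfull hD hG h hI hd
    · exact DegSeq.false_of_bottleneck hc₂ hc hn hfull hD hG h hI hd
  · simp only [DegSeq.MissersIndep, not_forall, not_not] at hI
    obtain ⟨a, b, x, x', hx, hx', hxx⟩ := hI
    obtain ⟨rfl, rfl⟩ := h.eq_of_edge hx hxx hx'
    exact DegSeq.false_of_triangle hc₂ hc hn hfull hD hG h hx hx' hxx
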